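/- Fix a precision $p\ge 1$. A rational number is a base-10 floating-point number of precision $p$ if it has the form $m\cdot 10^{\alpha}$ with $\alpha\in\mathbb{Z}$ (unbounded exponent) and mantissa $m$ a decimal number with $p$ digits after the decimal point such that $m=0$ or $0.1\le |m|<1$. A rounding function of precision $p$ is a map $[\cdot]:\mathbb{Q}\to\mathbb{Q}$ such that $[x]$ is a floating-point number of precision $p$ closest to the number obtained from $x$ by keeping the first $p+1$ digits of its mantissa, ties being broken by any fixed rule for which: (i) there is $c>0$ with $|x|/c\le |[x]|\le c|x|$ for all $x$; (ii) $[10^{\alpha}x]=10^{\alpha}[x]$ for all $\alpha\in\mathbb{Z}$; (iii) $[x]=[x']$ whenever $x$ and $x'$ agree on the first $p+1$ digits (with the same sign and exponent); (iv) $\operatorname{sign}([x])=\operatorname{sign}(x)$. Rounding is applied to vectors componentwise. For $M\in\mathbb{Q}^{d\times d}$ and $x\in\mathbb{Q}^d$, the rounded orbit of the linear dynamical system $(M,x)$ is the sequence $x^{(0)}=[x]$, $x^{(t+1)}=[Mx^{(t)}]$, where $Mx^{(t)}$ is computed exactly before rounding. Theorem. For every $p\ge 1$ and every rounding function $[\cdot]$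 of precision $p$, the floating-point point-to-point reachability problem is undecidable: there is no algorithm that, given $d\in\mathbb{N}$, a matrix $M\in\mathbb{Q}^{d\times d}$ (whose entries may be negative) and vectors $x,y\in\mathbb{Q}^d$, decides whether $y=x^{(t)}$ for some $t\ge 0$. -/

import Mathlib

open scoped Matrix

namespace FloatLDS

/-- `x` is a (signed) base-10 floating-point number of precision `p`, with unbounded exponent:
`x = m * 10 ^ α`, where the mantissa `m` has `p` digits after the decimal point
(`m = k / 10 ^ p` with `k` an integer) and either `m = 0` or `0.1 ≤ |m| < 1`. -/
def IsFloat (p : ℕ) (x : ℚ) : Prop :=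
  ∃ (k α : ℤ), x = ((k : ℚ) / 10 ^ p) * 10 ^ α ∧
    (k = 0 ∨ (1 / 10 ≤ |(k : ℚ) / 10 ^ p| ∧ |(k : ℚ) / 10 ^ p| < 1))

/-- For `x ≠ 0`, the unique integer `α` with `x = m * 10 ^ α` and `0.1 ≤ |m| < 1`.
(`Int.log 10 |x|` is the greatest `k` with `10 ^ k ≤ |x|`.) -/
def expo (x : ℚ) : ℤ := Int.log 10 |x| + 1

/-- The number obtained from `x` by keeping the first `n` decimal digits of its mantissa and
discarding all later ones; `trunc n 0 = 0`. -/
def trunc (n : ℕ) (x : ℚ) : ℚ :=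
  (SignType.sign x : ℚ) * (⌊|x| * 10 ^ ((n : ℤ) - expo x)⌋ : ℚ) * 10 ^ (expo x - (n : ℤ))

/-- `r` is a floating-point rounding function of precision `p` in base 10: `r x` is a
floating-point number of precision `p` closest to the number given by the first `p + 1` digits
of `x`.  Ties are broken by an arbitrary deterministic choice for which the last four
properties hold. -/
structure IsRounding (p : ℕ) (r : ℚ → ℚ) : Prop where
  isFloat : ∀ x, IsFloat p (r x)
  closest : ∀ x z, IsFloat p z → |r x - trunc (p + 1) x| ≤ |z - trunc (p + 1) x|
  log_bounded : ∃ c : ℚ, 0 < c ∧ ∀ x, |x| / c ≤ |r x| ∧ |r x| ≤ c * |x|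
  mantissa_based : ∀ (x : ℚ) (α : ℤ), r (10 ^ α * x) = 10 ^ α * r x
  finite_digits : ∀ x x', trunc (p + 1) x = trunc (p + 1) x' → r x = r x'
  sign_preserving : ∀ x, SignType.sign (r x) = SignType.sign x

/-- The rounded orbit of the linear dynamical system `(M, x)`: `x⁽⁰⁾ = [x]` and
`x⁽ᵗ⁺¹⁾ = [M x⁽ᵗ⁾]`, where `M x⁽ᵗ⁾` is computed exactly and then rounded componentwise. -/
def orbit (r : ℚ → ℚ) {d : ℕ} (M : Matrix (Fin d) (Fin d) ℚ) (x : Fin d → ℚ) :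
    ℕ → Fin d → ℚ
  | 0 => fun i => r (x i)
  | t + 1 => fun i => r ((M *ᵥ orbit r M x t) i)

/-- An instance of point-to-point reachability: a `d`-dimensional rational linear dynamical
system `(M, x)` and a target `y`. -/
structure Instance where
  d : ℕ
  M : Matrix (Fin d) (Fin d) ℚ
  x : Fin d → ℚ
  y : Fin d → ℚ

/-- The target is a point of the rounded orbit. -/
def Instance.Reaches (r : ℚ → ℚ) (I : Instance) : Prop :=
  ∃ t : ℕ, orbit r I.M I.x t = I.y

/-- Finite descriptions of instances: a list of rows, the initial vector and the target; each
rational is given by an integer numerator and a natural denominator. -/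
abbrev Code : Type := List (List (ℤ × ℕ)) × List (ℤ × ℕ) × List (ℤ × ℕ)

/-- A rational as numerator and denominator in lowest terms. -/
def ratCode (q : ℚ) : ℤ × ℕ := (q.num, q.den)

/-- The description of an instance, row by row. -/
def Instance.encode (I : Instance) : Code :=
  (List.ofFn fun i => List.ofFn fun j => ratCode (I.M i j),
    List.ofFn fun i => ratCode (I.x i),
    List.ofFn fun i => ratCode (I.y i))

theorem ratCode_injective : Function.Injective ratCode := by
  intro a b h
  simp only [ratCode, Prod.mk.injEq] at h
  exact Rat.ext h.1 h.2

/-- Distinct instances have distinct descriptions. -/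
theorem Instance.encode_injective : Function.Injective Instance.encode := by
  rintro ⟨d, M, x, y⟩ ⟨d', M', x', y'⟩ h
  simp only [Instance.encode, Prod.mk.injEq] at h
  obtain ⟨hM, hx, hy⟩ := h
  obtain rfl : d = d' := by simpa using congrArg List.length hx
  have hx' : x = x' := by
    funext i
    exact ratCode_injective (congrFun (List.ofFn_injective hx) i)
  have hy' : y = y' := by
    funext i
    exact ratCode_injective (congrFun (List.ofFn_injective hy) i)
  have hM' : M = M' := by
    funext i j
    exact ratCode_injective
      (congrFun (List.ofFn_injective (congrFun (List.ofFn_injective hM) i)) j)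
  subst hx' hy' hM'
  rfl

/-- The point-to-point reachability problem for the rounding function `r`, as the language of
descriptions of its positive instances. -/
def Reachability (r : ℚ → ℚ) (w : Code) : Prop :=
  ∃ I : Instance, I.encode = w ∧ I.Reaches r

end FloatLDS

/-! Rounding lets a linear map compare. If two powers of ten are more than `p` orders of magnitude
apart, the smaller one is lost when it is added to or subtracted from the larger, while equal powers
add up exactly to `2 * 10 ^ a`. Hence, for `B = 10 ^ (p + 1)`, the number `[[B ^ a + B ^ b] - B ^
a]` is `B ^ b` if `a ≤ b` and `0` otherwise (`IsRounding.map_sub_base_zpow`).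

Store an integer position as an exponent of `B`. Moving by a constant is then multiplication by a
constant, and the comparison yields either the head or zero, a value that linearly selects a branch.
This suits a machine with a head and markers on the integers whose only test is whether the head has
reached a marker. The head is kept in a coordinate belonging to the current state, with zeros for
the other states, so all instructions add up to one matrix. A machine step takes three rounded
steps: sum, difference, update. A marker is moved by adding a multiple of the head to it, which is
correct because the head then stands exactly on the marker (`Cfg.Safe`).

Such a machine executes counter programs: a register is a marker, reached by walking from `0`,
pushed by one, and left by walking back. Partial recursive functions compile to counter programs
(`Realizable.of_partrec`). A program for a universal function that clears its registers before
halting turns halting into the reaching of a single vector. -/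

namespace FloatLDS

/-! ### Counter programs and their semantics -/

/-- Programs over registers indexed by `ℕ`; `loop a P` means: while register `a` is nonzero,
decrement it and run `P`. -/
inductive Prog : Type
  | skip : Prog
  | inc (a : ℕ) : Prog
  | seq (P Q : Prog) : Prog
  | loop (a : ℕ) (P : Prog) : Prog

namespace Prog

open Function

/-- Big-step semantics. -/
inductive Big : Prog → (ℕ → ℕ) → (ℕ → ℕ) → Prop
  | skip (σ) : Big skip σ σ
  | inc (a σ) : Big (inc a) σ (update σ a (σ a + 1))
  | seq {P Q σ ρ τ} : Big P σ ρ → Big Q ρ τ → Big (seq P Q) σ τ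
  | loop_zero {a P σ} : σ a = 0 → Big (loop a P) σ σ
  | loop_succ {a P σ ρ τ} : σ a ≠ 0 → Big P (update σ a (σ a - 1)) ρ →
      Big (loop a P) ρ τ → Big (loop a P) σ τ

@[simp] theorem big_skip {σ τ} : Big skip σ τ ↔ τ = σ :=
  ⟨fun h => by cases h; rfl, fun h => h ▸ .skip σ⟩

@[simp] theorem big_inc {a σ τ} : Big (inc a) σ τ ↔ τ = update σ a (σ a + 1) :=
  ⟨fun h => by cases h; rfl, fun h => h ▸ .inc a σ⟩

@[simp] theorem big_seq {P Q σ τ} : Big (seq P Q) σ τ ↔ ∃ ρ, Big P σ ρ ∧ Big Q ρ τ :=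
  ⟨fun h => by cases h; exact ⟨_, ‹_›, ‹_›⟩, fun ⟨_, h, h'⟩ => .seq h h'⟩

/-- A loop whose body is deterministic along the sequence of states `s` stops at the first state
of `s` in which the loop register vanishes. -/
theorem big_loop_iff {a P} (s : ℕ → ℕ → ℕ)
    (hs : ∀ j, s j a ≠ 0 → ∀ τ, Big P (update (s j) a (s j a - 1)) τ ↔ τ = s (j + 1)) (τ) :
    Big (loop a P) (s 0) τ ↔ ∃ N, (∀ j < N, s j a ≠ 0) ∧ s N a = 0 ∧ τ = s N := by
  constructor
  · intro h
    suffices H : ∀ R σ, Big R σ τ → R = loop a P → ∀ s : ℕ → ℕ → ℕ, σ = s 0 →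
        (∀ j, s j a ≠ 0 → ∀ τ, Big P (update (s j) a (s j a - 1)) τ ↔ τ = s (j + 1)) →
        ∃ N, (∀ j < N, s j a ≠ 0) ∧ s N a = 0 ∧ τ = s N from H _ _ h rfl s rfl hs
    clear hs h s
    intro R σ h
    induction h with
    | skip | inc | seq => intro h; cases h
    | loop_zero h₀ =>
      rintro h s rfl -
      cases h
      exact ⟨0, by simp, h₀, rfl⟩
    | loop_succ h₀ h₁ _ _ ih =>
      rintro h s rfl hs
      cases h
      obtain ⟨N, h₁, h₂, h₃⟩ := ih rfl (fun j => s (j + 1)) ((hs 0 h₀ _).1 h₁)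
        (fun j => hs (j + 1))
      refine ⟨N + 1, ?_, h₂, h₃⟩
      rintro (_ | j) hj
      · exact h₀
      · exact h₁ j (by omega)
  · rintro ⟨N, h₁, h₂, rfl⟩
    induction N generalizing s with
    | zero => exact .loop_zero h₂
    | succ N ih =>
      exact .loop_succ (h₁ 0 (by omega)) ((hs 0 (h₁ 0 (by omega)) _).2 rfl)
        (ih (fun j => s (j + 1)) (fun j => hs (j + 1)) (fun j hj => h₁ (j + 1) (by omega)) h₂)

/-- `big_loop_iff` for a loop register that counts down to zero. -/
theorem big_loop_count {a P} (s : ℕ → ℕ → ℕ) (n : ℕ) (hn : ∀ j, s j a = n - j)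
    (hs : ∀ j < n, ∀ τ, Big P (update (s j) a (n - j - 1)) τ ↔ τ = s (j + 1)) (τ) :
    Big (loop a P) (s 0) τ ↔ τ = s n := by
  rw [big_loop_iff s (fun j hj => by rw [hn] at hj ⊢; exact hs j (by omega))]
  constructor
  · rintro ⟨N, h₁, h₂, rfl⟩
    have : N = n := by
      rw [hn] at h₂
      by_contra hne
      have := h₁ n (by omega)
      simp [hn] at this
    rw [this]
  · rintro rfl
    exact ⟨n, fun j hj => by rw [hn]; omega, by simp [hn], rfl⟩

/-- Set a register to zero. -/
def clear (a : ℕ) : Prog := loop a skip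

@[simp] theorem big_clear {a σ τ} : Big (clear a) σ τ ↔ τ = update σ a 0 := by
  have := big_loop_count (a := a) (P := skip) (fun j => update σ a (σ a - j)) (σ a) (by simp)
    (fun j _ τ => by simp [Nat.sub_sub]) τ
  simpa [clear] using this

/-- Move the content of a register, overwriting the target. -/
def move (a b : ℕ) : Prog := seq (clear b) (loop a (inc b))

theorem big_move {a b σ τ} (h : a ≠ b) :
    Big (move a b) σ τ ↔ τ = update (update σ b (σ a)) a 0 := by
  have := big_loop_count (a := a) (P := inc b)
    (fun j => update (update σ b j) a (σ a - j)) (σ a) (by simp)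
    (fun j _ τ => by
      simp only [big_inc]
      apply Eq.congr_right
      ext i
      simp only [update_apply]
      split_ifs <;> grind) τ
  simp only [move, big_seq, big_clear, exists_eq_left]
  convert this using 2
  · ext i
    simp only [update_apply]
    split_ifs <;> grind
  · simp

/-- Copy register `a` to register `b`, using the scratch register `t`. -/
def copy (a b t : ℕ) : Prog :=
  seq (clear b) (seq (loop a (seq (inc b) (inc t))) (loop t (inc a)))

theorem big_copy {a b t σ τ} (hab : a ≠ b) (hat : a ≠ t) (hbt : b ≠ t) (ht : σ t = 0) :
    Big (copy a b t) σ τ ↔ τ = update σ b (σ a) := by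
  have h₁ := big_loop_count (a := a) (P := seq (inc b) (inc t))
    (fun j => update (update (update σ b j) t j) a (σ a - j)) (σ a) (by simp)
    (fun j _ τ => by
      simp only [big_inc, big_seq, exists_eq_left]
      apply Eq.congr_right
      ext i
      simp only [update_apply]
      split_ifs <;> grind)
  have h₂ := big_loop_count (a := t) (P := inc a)
    (fun j => update (update (update σ b (σ a)) t (σ a - j)) a j) (σ a)
    (by simp [hat.symm])
    (fun j _ τ => by
      simp only [big_inc]
      apply Eq.congr_right
      ext i
      simp only [update_apply]
      split_ifs <;> grind) τ
  have e : update (update (update σ b 0) t 0) a (σ a - 0) = update σ b 0 := by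
    ext i
    simp only [update_apply]
    split_ifs <;> grind
  simp only [e] at h₁
  simp only [copy, big_seq, big_clear, exists_eq_left, h₁]
  simp only [Nat.sub_self, Nat.sub_zero] at h₂ ⊢
  rw [h₂]
  apply Eq.congr_right
  ext i
  simp only [update_apply]
  split_ifs <;> grind

/-- Set the registers `t, …, t + n - 1` to zero. -/
def clearRange : ℕ → ℕ → Prog
  | _, 0 => skip
  | t, n + 1 => seq (clear t) (clearRange (t + 1) n)

theorem big_clearRange {n t σ τ} : Big (clearRange t n) σ τ ↔
    τ = fun j => if t ≤ j ∧ j < t + n then 0 else σ j := by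
  induction n generalizing t σ with
  | zero =>
    simp only [clearRange, big_skip]
    apply Eq.congr_right
    ext j
    grind
  | succ n ih =>
    simp only [clearRange, big_seq, big_clear, exists_eq_left, ih]
    apply Eq.congr_right
    ext j
    simp only [update_apply]
    split_ifs <;> grind

end Prog

/-! ### Compiling partial recursive functions to counter programs -/

open Function Prog

/-- `f` is computed by programs reading its arguments from any registers `ins` and writing to any
register `out`, which leave the other registers unchanged and use scratch registers from `s` on
(supposed to be zero initially). -/
def Realizable {n : ℕ} (f : List.Vector ℕ n →. ℕ) : Prop :=
  ∀ (ins : Fin n → ℕ) (out s : ℕ), (∀ i, ins i < s) → out < s →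
    ∃ P : Prog, ∀ σ : ℕ → ℕ, (∀ i, s ≤ i → σ i = 0) → ∀ τ,
      Big P σ τ ↔ ∃ y ∈ f (List.Vector.ofFn fun i => σ (ins i)), τ = update σ out y

theorem realizable_zero : Realizable (PFun.lift fun _ : List.Vector ℕ 0 => 0) := by
  intro ins out s _ _
  exact ⟨clear out, fun σ _ τ => by simp⟩

theorem realizable_succ :
    Realizable (PFun.lift fun v : List.Vector ℕ 1 => v.head.succ) := by
  intro ins out s hins hout
  have h0 := hins 0
  refine ⟨seq (copy (ins 0) s (s + 1)) (seq (inc s) (move s out)), fun σ hσ τ => ?_⟩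
  have hs := hσ s le_rfl
  simp only [big_seq, big_inc, big_copy (σ := σ) (a := ins 0) (b := s) (t := s + 1)
    (by omega) (by omega) (by omega) (hσ _ (by omega)), exists_eq_left,
    big_move (show s ≠ out by omega)]
  simp only [PFun.coe_val, Part.mem_some_iff, exists_eq_left]
  apply Eq.congr_right
  ext i
  simp [update_apply, List.Vector.ofFn]
  split_ifs <;> grind

theorem realizable_get {n : ℕ} (i : Fin n) :
    Realizable (PFun.lift fun v : List.Vector ℕ n => v.get i) := by
  intro ins out s hins hout
  have h0 := hins i
  refine ⟨seq (copy (ins i) s (s + 1)) (move s out), fun σ hσ τ => ?_⟩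
  have hs := hσ s le_rfl
  simp only [big_seq, big_copy (σ := σ) (a := ins i) (b := s) (t := s + 1)
    (by omega) (by omega) (by omega) (hσ _ (by omega)), exists_eq_left,
    big_move (show s ≠ out by omega)]
  simp only [PFun.coe_val, Part.mem_some_iff, exists_eq_left, List.Vector.get_ofFn]
  apply Eq.congr_right
  ext j
  simp only [update_apply]
  split_ifs <;> grind

theorem mem_mOfFn {n : ℕ} (g : Fin n → Part ℕ) (w : List.Vector ℕ n) :
    w ∈ List.Vector.mOfFn g ↔ ∀ i, w.get i ∈ g i := by
  induction n with
  | zero =>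
    simp [List.Vector.mOfFn, pure, eq_iff_true_of_subsingleton]
  | succ n ih =>
    simp only [List.Vector.mOfFn, Part.bind_eq_bind, Part.mem_bind_iff, Part.pure_eq_some,
      Part.mem_some_iff, ih, Fin.forall_fin_succ]
    constructor
    · rintro ⟨a, ha, v, hv, rfl⟩
      simpa using ⟨ha, hv⟩
    · rintro ⟨h0, hs⟩
      exact ⟨_, h0, w.tail, fun i => by simpa [List.Vector.get_tail_succ] using hs i,
        by simp [List.Vector.get_zero]⟩

/-- Running several realizers, with outputs to consecutive registers. -/
theorem exists_prog_tuple {m : ℕ} (ins : Fin m → ℕ) (S n : ℕ)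
    (g : Fin n → (List.Vector ℕ m →. ℕ)) (hg : ∀ i, Realizable (g i)) (t : ℕ)
    (hins : ∀ i, ins i < t) (ht : t + n = S) :
    ∃ P : Prog, ∀ σ : ℕ → ℕ, (∀ i, S ≤ i → σ i = 0) → ∀ τ, Big P σ τ ↔
      ∃ w : Fin n → ℕ, (∀ i, w i ∈ g i (List.Vector.ofFn fun i => σ (ins i))) ∧
        τ = fun j => if h : t ≤ j ∧ j < t + n then w ⟨j - t, by omega⟩ else σ j := by
  induction n generalizing t with
  | zero =>
    refine ⟨skip, fun σ _ τ => ?_⟩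
    simp only [big_skip, IsEmpty.forall_iff, true_and]
    have : ∀ j, ¬ (t ≤ j ∧ j < t + 0) := by omega
    simp only [this, dif_neg, not_false_eq_true, exists_const]
  | succ n ih =>
    obtain ⟨P₀, h₀⟩ := hg 0 ins t S (fun i => by have := hins i; omega) (by omega)
    obtain ⟨P₁, h₁⟩ := ih (fun i => g i.succ) (fun i => hg _) (t + 1)
      (fun i => by have := hins i; omega) (by omega)
    refine ⟨seq P₀ P₁, fun σ hσ τ => ?_⟩
    have key : ∀ y τ, Big P₁ (update σ t y) τ ↔ _ := fun y τ => h₁ (update σ t y)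
      (fun i hi => by rw [update_of_ne (by omega)]; exact hσ i hi) τ
    have e : ∀ y i, update σ t y (ins i) = σ (ins i) := fun y i =>
      update_of_ne (hins i).ne _ _
    simp only [e] at key
    simp only [big_seq, h₀ σ hσ]
    constructor
    · rintro ⟨_, ⟨y, hy, rfl⟩, hb⟩
      obtain ⟨w, hw, rfl⟩ := (key y τ).1 hb
      refine ⟨Fin.cons y w, fun i => ?_, ?_⟩
      · refine Fin.cases ?_ (fun i => ?_) i
        · simpa using hy
        · simpa using hw i
      · ext j
        by_cases hj : t + 1 ≤ j ∧ j < t + 1 + n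
        · rw [dif_pos hj, dif_pos (by omega)]
          have : (⟨j - t, by omega⟩ : Fin (n + 1)) = Fin.succ ⟨j - (t + 1), by omega⟩ := by
            ext; simp; omega
          rw [this, Fin.cons_succ]
        · rw [dif_neg hj]
          by_cases hj' : j = t
          · subst hj'
            simp
          · rw [dif_neg (by omega), update_of_ne hj']
    · rintro ⟨w, hw, rfl⟩
      refine ⟨_, ⟨w 0, hw 0, rfl⟩, (key _ _).2 ⟨fun i => w i.succ, fun i => hw i.succ, ?_⟩⟩
      ext j
      by_cases hj : t + 1 ≤ j ∧ j < t + 1 + n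
      · rw [dif_pos hj, dif_pos (by omega)]
        congr 1
        ext; simp; omega
      · rw [dif_neg hj]
        by_cases hj' : j = t
        · subst hj'
          simp
        · rw [dif_neg (by omega), update_of_ne hj']

/-- The intermediate values occupy the first `n` scratch registers and are erased at the end.
Divergence needs no separate treatment: the equivalence in `Realizable` says that no final state
exists. -/
theorem Realizable.comp {m n : ℕ} {f : List.Vector ℕ n →. ℕ} {g : Fin n → (List.Vector ℕ m →. ℕ)}
    (hf : Realizable f) (hg : ∀ i, Realizable (g i)) :
    Realizable fun v => (List.Vector.mOfFn fun i => g i v).bind f := by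
  intro ins out s hins hout
  obtain ⟨P, hP⟩ := exists_prog_tuple ins (s + n) n g hg s hins rfl
  obtain ⟨Q, hQ⟩ := hf (fun i => s + i) out (s + n) (by intro i; simp) (by omega)
  refine ⟨seq P (seq Q (clearRange s n)), fun σ hσ τ => ?_⟩
  simp only [big_seq, hP σ (fun i hi => hσ i (by omega)), big_clearRange]
  have key : ∀ w : Fin n → ℕ, ∀ ρ, Big Q
      (fun j => if h : s ≤ j ∧ j < s + n then w ⟨j - s, by omega⟩ else σ j) ρ ↔ _ :=
    fun w => hQ _ (fun i hi => by rw [dif_neg (by omega)]; exact hσ i (by omega))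
  have e : ∀ w : Fin n → ℕ, ∀ y, (fun j => if s ≤ j ∧ j < s + n then 0 else update
      (fun j => if h : s ≤ j ∧ j < s + n then w ⟨j - s, by omega⟩ else σ j) out y j) =
      update σ out y := by
    intro w y
    ext j
    by_cases hj : s ≤ j ∧ j < s + n
    · rw [if_pos hj, update_of_ne (by omega), hσ j hj.1]
    · rw [if_neg hj]
      simp only [update_apply, dif_neg hj]
  constructor
  · rintro ⟨_, ⟨w, hw, rfl⟩, ρ, hb, rfl⟩
    obtain ⟨y, hy, rfl⟩ := (key w ρ).1 hb
    exact ⟨y, Part.mem_bind_iff.2 ⟨List.Vector.ofFn w, (mem_mOfFn _ _).2 (by simpa using hw),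
      by simpa using hy⟩, e w y⟩
  · rintro ⟨y, hy, rfl⟩
    obtain ⟨w, hw, hy⟩ := Part.mem_bind_iff.1 hy
    rw [mem_mOfFn] at hw
    refine ⟨_, ⟨w.get, hw, rfl⟩, _, (key _ _).2 ⟨y, ?_, rfl⟩, (e _ _).symm⟩
    have : (List.Vector.ofFn w.get) = w := List.Vector.ofFn_get w
    simpa [this] using hy

/-- Registers `s`, `s + 1`, `s + 2` hold the counter, the accumulated value and the number of rounds
left. The last is a copy of the first argument, since a loop destroys its register and the inputs
must survive. -/
theorem Realizable.prec {n : ℕ} {f : List.Vector ℕ n → ℕ} {g : List.Vector ℕ (n + 2) → ℕ}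
    (hf : Realizable (PFun.lift f)) (hg : Realizable (PFun.lift g)) :
    Realizable (PFun.lift fun v : List.Vector ℕ (n + 1) =>
      v.head.rec (f v.tail) fun y IH => g (y ::ᵥ IH ::ᵥ v.tail)) := by
  intro ins out s hins hout
  obtain ⟨P, hP⟩ := hf (fun i => ins i.succ) (s + 1) (s + 3)
    (fun i => by have := hins i.succ; omega) (by omega)
  obtain ⟨Q, hQ⟩ := hg (Fin.cons s (Fin.cons (s + 1) fun i => ins i.succ)) (s + 1) (s + 3)
    (by
      refine Fin.cases (by simp) (Fin.cases (by simp) fun i => ?_)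
      have := hins i.succ
      simp only [Fin.cons_succ]
      omega) (by omega)
  refine ⟨seq (copy (ins 0) (s + 2) (s + 3)) (seq P (seq (loop (s + 2) (seq Q (inc s)))
    (seq (clear s) (move (s + 1) out)))), fun σ hσ τ => ?_⟩
  have hi0 := hins 0
  set v : List.Vector ℕ n := List.Vector.ofFn fun i => σ (ins i.succ) with hv
  set R : ℕ → ℕ := fun k => Nat.rec (f v) (fun y IH => g (y ::ᵥ IH ::ᵥ v)) k with hR
  have hP' : ∀ τ, Big P (update σ (s + 2) (σ (ins 0))) τ ↔
      τ = update (update σ (s + 2) (σ (ins 0))) (s + 1) (f v) := fun τ => by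
    rw [hP _ (fun i hi => by rw [update_of_ne (by omega)]; exact hσ i (by omega))]
    have : ∀ i : Fin n, update σ (s + 2) (σ (ins 0)) (ins i.succ) = σ (ins i.succ) := fun i =>
      update_of_ne (by have := hins i.succ; omega) _ _
    simp [this, hv]
  have hloop := big_loop_count (a := s + 2) (P := seq Q (inc s))
    (fun j => update (update (update σ s j) (s + 1) (R j)) (s + 2) (σ (ins 0) - j)) (σ (ins 0))
    (by simp) (fun j _ τ => by
      have : ∀ τ, Big Q (update (update (update (update σ s j) (s + 1) (R j)) (s + 2)
          (σ (ins 0) - j)) (s + 2) (σ (ins 0) - j - 1)) τ ↔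
          τ = update (update (update σ s j) (s + 1) (R (j + 1))) (s + 2) (σ (ins 0) - j - 1) := by
        intro τ
        rw [hQ _ (fun i hi => by
          rw [update_of_ne (by omega), update_of_ne (by omega), update_of_ne (by omega),
            update_of_ne (by omega)]
          exact hσ i (by omega))]
        have h1 : ∀ i : Fin n, ins i.succ < s := fun i => hins i.succ
        have h2 : ∀ i : Fin n, ins i.succ ≠ s := fun i => by have := h1 i; omega
        have h3 : ∀ i : Fin n, ins i.succ ≠ s + 1 := fun i => by have := h1 i; omega
        have h4 : ∀ i : Fin n, ins i.succ ≠ s + 2 := fun i => by have := h1 i; omega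
        simp only [PFun.coe_val, Part.mem_some_iff, exists_eq_left, List.Vector.ofFn,
          Fin.cons_zero, Fin.cons_succ, update_idem]
        simp only [update_apply, h2, h3, h4, if_false, ← hv]
        apply Eq.congr_right
        ext i
        simp only [update_apply, hR]
        split_ifs <;> grind
      simp only [big_seq, this, exists_eq_left, big_inc]
      apply Eq.congr_right
      ext i
      simp only [update_apply]
      split_ifs <;> grind)
  have e0 : update (update (update σ s 0) (s + 1) (R 0)) (s + 2) (σ (ins 0) - 0) =
      update (update σ (s + 2) (σ (ins 0))) (s + 1) (f v) := by
    have := hσ s le_rfl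
    have hR0 : R 0 = f v := rfl
    ext i
    simp only [update_apply, hR0]
    split_ifs <;> grind
  simp only [e0] at hloop
  simp only [big_seq, big_copy (σ := σ) (a := ins 0) (b := s + 2) (t := s + 3)
    (by omega) (by omega) (by omega) (hσ _ (by omega)), exists_eq_left, hP', hloop, big_clear,
    big_move (show s + 1 ≠ out by omega)]
  simp only [PFun.coe_val, Part.mem_some_iff, exists_eq_left, List.Vector.ofFn,
    List.Vector.head_cons, List.Vector.tail_cons, ← hv]
  apply Eq.congr_right
  have h0 := hσ s le_rfl
  have h1 := hσ (s + 1) (by omega)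
  have h2 := hσ (s + 2) (by omega)
  ext i
  simp only [update_apply]
  split_ifs <;> grind

/-- The candidate sits in `s` and its value in `s + 1`, which is also the loop register, so the loop
stops at the first zero of `f`. This is the only loop run without an a priori bound, hence the
source of divergence. -/
theorem Realizable.rfind {n : ℕ} {f : List.Vector ℕ (n + 1) → ℕ}
    (hf : Realizable (PFun.lift f)) :
    Realizable fun v : List.Vector ℕ n => Nat.rfind fun k => Part.some (f (k ::ᵥ v) = 0) := by
  intro ins out s hins hout
  obtain ⟨P, hP⟩ := hf (Fin.cons s ins) (s + 1) (s + 2)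
    (Fin.cases (by simp) fun i => by have := hins i; simp only [Fin.cons_succ]; omega) (by omega)
  refine ⟨seq P (seq (loop (s + 1) (seq (clear (s + 1)) (seq (inc s) P))) (move s out)),
    fun σ hσ τ => ?_⟩
  set v : List.Vector ℕ n := List.Vector.ofFn fun i => σ (ins i) with hv
  have hP' : ∀ k z τ, Big P (update (update σ s k) (s + 1) z) τ ↔
      τ = update (update σ s k) (s + 1) (f (k ::ᵥ v)) := fun k z τ => by
    rw [hP _ (fun i hi => by
      rw [update_of_ne (by omega), update_of_ne (by omega)]; exact hσ i (by omega))]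
    have h2 : ∀ i : Fin n, ins i ≠ s := fun i => by have := hins i; omega
    have h3 : ∀ i : Fin n, ins i ≠ s + 1 := fun i => by have := hins i; omega
    simp only [PFun.coe_val, Part.mem_some_iff, exists_eq_left, List.Vector.ofFn,
      Fin.cons_zero, Fin.cons_succ, update_idem]
    simp only [update_apply, h2, h3, if_false, ← hv]
    simp
  have hloop := big_loop_iff (a := s + 1) (P := seq (clear (s + 1)) (seq (inc s) P))
    (fun j => update (update σ s j) (s + 1) (f (j ::ᵥ v))) (fun j _ τ => by
      simp only [big_seq, big_clear, big_inc, exists_eq_left, update_idem]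
      rw [← hP' (j + 1) 0 τ]
      apply iff_of_eq
      congr 1
      ext i
      simp only [update_apply]
      split_ifs <;> grind)
  have e0 : σ = update (update σ s 0) (s + 1) 0 := by
    have h0 := hσ s le_rfl
    have h1 := hσ (s + 1) (by omega)
    ext i
    simp only [update_apply]
    split_ifs <;> grind
  have hP0 : ∀ τ, Big P σ τ ↔ τ = update (update σ s 0) (s + 1) (f (0 ::ᵥ v)) := fun τ => by
    rw [← hP' 0 0, ← e0]
  simp only [big_seq, hP0, exists_eq_left, hloop, big_move (show s ≠ out by omega)]
  have h0 := hσ s le_rfl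
  have h1 := hσ (s + 1) (by omega)
  have e : ∀ N, f (N ::ᵥ v) = 0 → update (update (update (update σ s N) (s + 1) (f (N ::ᵥ v))) out
      (update (update σ s N) (s + 1) (f (N ::ᵥ v)) s)) s 0 = update σ out N := by
    intro N hN
    ext i
    simp only [update_apply]
    split_ifs <;> grind
  constructor
  · rintro ⟨_, ⟨N, hlt, hN, rfl⟩, rfl⟩
    simp only [update_self] at hN hlt
    exact ⟨N, Nat.mem_rfind.2 ⟨by simpa using hN, fun {m} hm => by simpa using hlt m hm⟩, e N hN⟩
  · rintro ⟨N, hN, rfl⟩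
    obtain ⟨hN, hlt⟩ := Nat.mem_rfind.1 hN
    have hN' : f (N ::ᵥ v) = 0 := by simpa using hN
    exact ⟨_, ⟨N, fun j hj => by simpa using hlt hj, by simpa using hN', rfl⟩, (e N hN').symm⟩

theorem Realizable.of_primrec {n : ℕ} {f : List.Vector ℕ n → ℕ} (hf : Nat.Primrec' f) :
    Realizable (PFun.lift f) := by
  induction hf with
  | zero => exact realizable_zero
  | succ => exact realizable_succ
  | get i => exact realizable_get i
  | @comp m n f g _ _ hf hg =>
    have := hf.comp hg
    simp only [PFun.coe_val, Vector.mOfFn_part_some] at this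
    have e : (fun v => (Part.some (List.Vector.ofFn fun i => g i v)).bind (PFun.lift f)) =
        PFun.lift fun v => f (List.Vector.ofFn fun i => g i v) :=
      funext fun v => Part.bind_some _ _
    rwa [e] at this
  | prec _ _ hf hg => exact hf.prec hg

theorem Realizable.of_partrec {n : ℕ} {f : List.Vector ℕ n →. ℕ} (hf : Nat.Partrec' f) :
    Realizable f := by
  induction hf with
  | prim hf => exact .of_primrec hf
  | comp g _ _ hf hg => exact hf.comp hg
  | rfind _ hf => exact hf.rfind

/-- A program which halts with input `n` iff `f n` is defined, and then clears all registers. -/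
theorem exists_prog_dom {f : ℕ →. ℕ} (hf : Partrec f) :
    ∃ P : Prog, ∀ n τ, Big P (update 0 0 n) τ ↔ (f n).Dom ∧ τ = 0 := by
  obtain ⟨P, hP⟩ := Realizable.of_partrec (Nat.Partrec'.part_iff₁.2 hf) (fun _ => 0) 0 1
    (by simp) (by simp)
  refine ⟨seq P (clear 0), fun n τ => ?_⟩
  have := hP (update 0 0 n) (fun i hi => by rw [update_of_ne (by omega)]; rfl)
  simp only [big_seq, this, big_clear]
  have e : ∀ y, update (update (update (0 : ℕ → ℕ) 0 n) 0 y) 0 0 = 0 := by simp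
  simp only [List.Vector.ofFn, List.Vector.head_cons, update_self, Part.dom_iff_mem]
  constructor
  · rintro ⟨_, ⟨y, hy, rfl⟩, rfl⟩
    exact ⟨⟨y, hy⟩, e y⟩
  · rintro ⟨⟨y, hy⟩, rfl⟩
    exact ⟨_, ⟨y, hy, rfl⟩, (e y).symm⟩

/-! ### Small-step execution with a stack of programs -/

/-- One step of the machine executing a stack of programs. -/
def stackStep : List Prog × (ℕ → ℕ) → List Prog × (ℕ → ℕ)
  | ([], σ) => ([], σ)
  | (skip :: K, σ) => (K, σ)
  | (inc a :: K, σ) => (K, update σ a (σ a + 1))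
  | (seq P Q :: K, σ) => (P :: Q :: K, σ)
  | (loop a P :: K, σ) =>
    if σ a = 0 then (K, σ) else (P :: loop a P :: K, update σ a (σ a - 1))

theorem Prog.Big.exists_iterate {P σ τ} (h : Big P σ τ) (K : List Prog) :
    ∃ n, stackStep^[n] (P :: K, σ) = (K, τ) := by
  induction h generalizing K with
  | skip σ => exact ⟨1, rfl⟩
  | inc a σ => exact ⟨1, rfl⟩
  | @seq P Q _ _ _ _ _ ih₁ ih₂ =>
    obtain ⟨n, hn⟩ := ih₁ (Q :: K)
    obtain ⟨m, hm⟩ := ih₂ K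
    exact ⟨m + n + 1, by rw [iterate_succ_apply, stackStep, iterate_add_apply, hn, hm]⟩
  | loop_zero h => exact ⟨1, by simp [stackStep, h]⟩
  | @loop_succ a P _ _ _ h _ _ ih₁ ih₂ =>
    obtain ⟨n, hn⟩ := ih₁ (loop a P :: K)
    obtain ⟨m, hm⟩ := ih₂ K
    exact ⟨m + n + 1, by rw [iterate_succ_apply, stackStep, if_neg h, iterate_add_apply, hn, hm]⟩

/-- Strong induction on the number of steps: unfolding a `seq` or a loop leaves two programs to run
in turn, and the bound `m < n` permits a second use of the induction hypothesis. -/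
theorem exists_big_of_iterate (n : ℕ) : ∀ {P K σ τ}, stackStep^[n] (P :: K, σ) = ([], τ) →
    ∃ ρ, Big P σ ρ ∧ ∃ m < n, stackStep^[m] (K, ρ) = ([], τ) := by
  induction n using Nat.strong_induction_on with
  | _ n ih =>
    intro P K σ τ h
    obtain _ | n := n
    · simp at h
    rw [iterate_succ_apply] at h
    cases P with
    | skip => exact ⟨_, .skip σ, n, by omega, h⟩
    | inc a => exact ⟨_, .inc a σ, n, by omega, h⟩
    | seq P Q =>
      obtain ⟨ρ, hb, m, hm, h⟩ := ih n (by omega) h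
      obtain ⟨ρ', hb', m', hm', h⟩ := ih m (by omega) h
      exact ⟨ρ', .seq hb hb', m', by omega, h⟩
    | loop a P =>
      by_cases h0 : σ a = 0
      · rw [stackStep, if_pos h0] at h
        exact ⟨_, .loop_zero h0, n, by omega, h⟩
      · rw [stackStep, if_neg h0] at h
        obtain ⟨ρ, hb, m, hm, h⟩ := ih n (by omega) h
        obtain ⟨ρ', hb', m', hm', h⟩ := ih m (by omega) h
        exact ⟨ρ', .loop_succ h0 hb hb', m', by omega, h⟩

theorem exists_iterate_stackStep_iff {P σ τ} :
    (∃ n, stackStep^[n] ([P], σ) = ([], τ)) ↔ Big P σ τ := by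
  constructor
  · rintro ⟨n, h⟩
    obtain ⟨ρ, hb, m, -, hm⟩ := exists_big_of_iterate n h
    have : ∀ m, stackStep^[m] ([], ρ) = ([], ρ) := fun m => iterate_fixed rfl m
    rw [this] at hm
    obtain rfl : ρ = τ := by simpa using hm
    exact hb
  · exact fun h => h.exists_iterate []

/-- The stacks arising from `P :: K` before `K` is reached. -/
def subStacks : Prog → List Prog → Set (List Prog)
  | skip, K => {skip :: K}
  | inc a, K => {inc a :: K}
  | seq P Q, K => {seq P Q :: K} ∪ (subStacks P (Q :: K) ∪ subStacks Q K)
  | loop a P, K => {loop a P :: K} ∪ subStacks P (loop a P :: K)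

/-- This is what makes the dimension finite: a stack is a control state, and a loop body always runs
on the same continuation, so stacks do not grow with the number of iterations. -/
theorem finite_subStacks (P : Prog) (K : List Prog) : (subStacks P K).Finite := by
  induction P generalizing K with
  | skip | inc => exact Set.finite_singleton _
  | seq P Q ih₁ ih₂ => exact (Set.finite_singleton _).union ((ih₁ _).union (ih₂ _))
  | loop a P ih => exact (Set.finite_singleton _).union (ih _)

theorem self_mem_subStacks (P : Prog) (K : List Prog) : P :: K ∈ subStacks P K := by
  cases P <;> simp [subStacks]

theorem stackStep_mem_subStacks {P : Prog} {K L : List Prog} (σ) (h : L ∈ subStacks P K) :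
    (stackStep (L, σ)).1 ∈ subStacks P K ∨ (stackStep (L, σ)).1 = K := by
  induction P generalizing K with
  | skip | inc =>
    obtain rfl : L = _ := h
    exact .inr rfl
  | seq P Q ih₁ ih₂ =>
    rcases h with h | h | h
    · obtain rfl : L = _ := h
      exact .inl (.inr (.inl (self_mem_subStacks _ _)))
    · rcases ih₁ h with h | h
      · exact .inl (.inr (.inl h))
      · rw [h]
        exact .inl (.inr (.inr (self_mem_subStacks _ _)))
    · rcases ih₂ h with h | h
      · exact .inl (.inr (.inr h))
      · exact .inr h
  | loop a P ih =>
    rcases h with h | h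
    · obtain rfl : L = _ := h
      by_cases h0 : σ a = 0
      · exact .inr (by simp [stackStep, h0])
      · refine .inl (.inr ?_)
        simpa [stackStep, h0] using self_mem_subStacks _ _
    · rcases ih h with h | h
      · exact .inl (.inr h)
      · exact .inl (.inl h)

/-! ### Marker machines and their simulation of the stack machine -/

/-- An instruction of a marker machine: compare the position of the head with a marker. If the
head is at or beyond the marker, move the marker by `push` and the head by `shiftGe` and go to
`nextGe`, otherwise move the head by `shiftLt` and go to `nextLt`. -/
structure Instr (Q V : Type) where
  mark : V
  nextGe : Q
  shiftGe : ℤ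
  push : ℤ
  nextLt : Q
  shiftLt : ℤ

/-- A configuration of a marker machine: state, head position, marker positions. -/
structure Cfg (Q V : Type) where
  state : Q
  head : ℤ
  pos : V → ℤ

section Machine

variable {Q V : Type} [DecidableEq V]

/-- One step of the marker machine with program `I`. -/
def Cfg.step (I : Q → Instr Q V) (a : Cfg Q V) : Cfg Q V :=
  if a.pos (I a.state).mark ≤ a.head then
    ⟨(I a.state).nextGe, a.head + (I a.state).shiftGe,
      update a.pos (I a.state).mark (a.pos (I a.state).mark + (I a.state).push)⟩
  else ⟨(I a.state).nextLt, a.head + (I a.state).shiftLt, a.pos⟩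

/-- A marker may be pushed only by a head which is not beyond it. -/
def Cfg.Safe (I : Q → Instr Q V) (a : Cfg Q V) : Prop :=
  (I a.state).push = 0 ∨ a.head ≤ a.pos (I a.state).mark

/-- A step from a safe configuration. -/
def SafeStep (I : Q → Instr Q V) (a b : Cfg Q V) : Prop := a.Safe I ∧ a.step I = b

theorem exists_iterate_of_transGen {I : Q → Instr Q V} {a b : Cfg Q V}
    (h : Relation.TransGen (SafeStep I) a b) :
    ∃ n, 0 < n ∧ (Cfg.step I)^[n] a = b ∧ ∀ j < n, ((Cfg.step I)^[j] a).Safe I := by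
  induction h with
  | single h => exact ⟨1, one_pos, h.2, fun j hj => by
      obtain rfl : j = 0 := by omega
      exact h.1⟩
  | tail _ h ih =>
    obtain ⟨n, -, rfl, hs⟩ := ih
    refine ⟨n + 1, by omega, by rw [iterate_succ_apply', h.2], fun j hj => ?_⟩
    rcases Nat.lt_succ_iff_lt_or_eq.1 hj with hj | rfl
    · exact hs j hj
    · exact h.1

end Machine

/-- The stack after an `inc` instruction or after entering the body of a loop. -/
def afterPush : List Prog → List Prog
  | inc _ :: K => K
  | loop a P :: K => P :: loop a P :: K
  | _ => []

/-- The marker machine executing stacks of programs. The register `a` is the marker `some a`, and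
the marker `none` stays at `1`. In phase `0` and `1` the head seeks a marker, in phase `2` it
returns to `0`. -/
def progInstr : List Prog × Fin 3 → Instr (List Prog × Fin 3) (Option ℕ)
  | (L, 2) => ⟨none, (L, 2), -1, 0, (afterPush L, 0), 0⟩
  | (inc a :: K, _) => ⟨some a, (inc a :: K, 2), 0, 1, (inc a :: K, 0), 1⟩
  | (loop a P :: K, 0) => ⟨some a, (K, 0), 0, 0, (loop a P :: K, 1), 1⟩
  | (loop a P :: K, _) => ⟨some a, (loop a P :: K, 2), 0, -1, (loop a P :: K, 1), 1⟩
  | (skip :: K, _) => ⟨none, (K, 0), 0, 0, (K, 0), 0⟩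
  | (seq P Q :: K, _) => ⟨none, (P :: Q :: K, 0), 0, 0, (P :: Q :: K, 0), 0⟩
  | ([], _) => ⟨none, ([], 0), 0, 0, ([], 0), 0⟩

/-- The positions of the markers. -/
def markerPos (σ : ℕ → ℕ) : Option ℕ → ℤ
  | none => 1
  | some a => σ a

/-- The configuration of the marker machine for a configuration of the stack machine. -/
def toCfg (a : List Prog × (ℕ → ℕ)) : Cfg (List Prog × Fin 3) (Option ℕ) :=
  ⟨(a.1, 0), 0, markerPos a.2⟩

theorem update_markerPos (σ : ℕ → ℕ) (a m : ℕ) :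
    update (markerPos σ) (some a) (m : ℤ) = markerPos (update σ a m) := by
  ext (_ | i)
  · simp [markerPos]
  · by_cases h : i = a
    · subst h; simp [markerPos]
    · simp [markerPos, h]

/-- Induction on the distance `k` still to be walked. Unit steps from below land exactly on the
marker, so the push that follows is safe. -/
theorem reflTransGen_seek {q : List Prog × Fin 3} {σ : ℕ → ℕ} {a : ℕ}
    (hm : (progInstr q).mark = some a) (hn : (progInstr q).nextLt = q)
    (hs : (progInstr q).shiftLt = 1) (k : ℕ) :
    Relation.ReflTransGen (SafeStep progInstr) ⟨q, σ a - k, markerPos σ⟩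
      ⟨q, σ a, markerPos σ⟩ := by
  induction k with
  | zero => simpa using Relation.ReflTransGen.refl
  | succ k ih =>
    refine .head ⟨.inr ?_, ?_⟩ ih
    · simp only [hm, markerPos]
      omega
    · rw [Cfg.step, if_neg]
      · simp only [hn, hs, Cfg.mk.injEq, true_and, and_true]
        push_cast
        ring
      · simp only [hm, markerPos]
        push_cast
        omega

theorem transGen_return (L : List Prog) (σ : ℕ → ℕ) (k : ℕ) :
    Relation.TransGen (SafeStep progInstr) ⟨(L, 2), k, markerPos σ⟩ (toCfg (afterPush L, σ)) := by
  induction k with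
  | zero =>
    refine .single ⟨.inl (by simp [progInstr]), ?_⟩
    rw [Cfg.step, if_neg (by simp [progInstr, markerPos])]
    simp [progInstr, toCfg]
  | succ k ih =>
    refine .head ⟨.inl (by simp [progInstr]), ?_⟩ ih
    rw [Cfg.step, if_pos (by simp [progInstr, markerPos])]
    simp [progInstr]

theorem transGen_toCfg (a : List Prog × (ℕ → ℕ)) :
    Relation.TransGen (SafeStep progInstr) (toCfg a) (toCfg (stackStep a)) := by
  obtain ⟨_ | ⟨_ | a | ⟨P, Q⟩ | ⟨a, P⟩, K⟩, σ⟩ := a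
  · refine .single ⟨.inl (by simp [progInstr, toCfg]), ?_⟩
    simp [Cfg.step, toCfg, progInstr, stackStep]
  · refine .single ⟨.inl (by simp [progInstr, toCfg]), ?_⟩
    simp [Cfg.step, toCfg, progInstr, stackStep]
  · have h := reflTransGen_seek (q := (inc a :: K, 0)) (σ := σ) (a := a) rfl rfl rfl (σ a)
    rw [sub_self] at h
    refine .trans_right h (.head ⟨.inr ?_, ?_⟩
      (transGen_return (inc a :: K) (update σ a (σ a + 1)) (σ a)))
    · simp [progInstr, markerPos]
    · rw [Cfg.step, if_pos (by simp [progInstr, markerPos])]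
      simp [progInstr, ← update_markerPos, markerPos]
  · refine .single ⟨.inl (by simp [progInstr, toCfg]), ?_⟩
    simp [Cfg.step, toCfg, progInstr, stackStep]
  · by_cases h0 : σ a = 0
    · refine .single ⟨.inl (by simp [progInstr, toCfg]), ?_⟩
      rw [Cfg.step, if_pos (by simp [progInstr, toCfg, markerPos, h0])]
      simp [progInstr, toCfg, stackStep, h0]
    · have h := reflTransGen_seek (q := (loop a P :: K, 1)) (σ := σ) (a := a) rfl rfl rfl
        (σ a - 1)
      refine .head ⟨.inl (by simp [progInstr, toCfg]), ?_⟩ (.trans_right h (.head ⟨.inr ?_, ?_⟩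
        (?_ : Relation.TransGen _ ⟨(loop a P :: K, 2), σ a,
          markerPos (update σ a (σ a - 1))⟩ _)))
      · rw [Cfg.step, if_neg (by simp [progInstr, toCfg, markerPos]; omega)]
        simp [progInstr, toCfg]
        omega
      · simp [progInstr, markerPos]
      · rw [Cfg.step, if_pos (by simp [progInstr, markerPos])]
        simp only [progInstr, ← update_markerPos, markerPos, Cfg.mk.injEq, true_and, add_zero]
        congr 1
        omega
      · have := transGen_return (loop a P :: K) (update σ a (σ a - 1)) (σ a)
        simpa [stackStep, h0, afterPush] using this

/-- Every stack step costs at least one machine step, whence `k ≤ n`. Facts about an arbitrary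
machine time thus follow from a stack run of equal length. -/
theorem exists_iterate_toCfg (a : List Prog × (ℕ → ℕ)) (k : ℕ) :
    ∃ n, k ≤ n ∧ (Cfg.step progInstr)^[n] (toCfg a) = toCfg (stackStep^[k] a) ∧
      ∀ j < n, ((Cfg.step progInstr)^[j] (toCfg a)).Safe progInstr := by
  induction k with
  | zero => exact ⟨0, le_rfl, rfl, by simp⟩
  | succ k ih =>
    obtain ⟨n, hn, he, hs⟩ := ih
    obtain ⟨m, hm, he', hs'⟩ := exists_iterate_of_transGen (transGen_toCfg (stackStep^[k] a))
    refine ⟨m + n, by omega, by rw [iterate_add_apply, he, he', iterate_succ_apply'],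
      fun j hj => ?_⟩
    rcases lt_or_ge j n with h | h
    · exact hs j h
    · have := hs' (j - n) (by omega)
      rwa [← he, ← iterate_add_apply, Nat.sub_add_cancel h] at this

theorem safe_iterate_toCfg (a : List Prog × (ℕ → ℕ)) (j : ℕ) :
    ((Cfg.step progInstr)^[j] (toCfg a)).Safe progInstr := by
  obtain ⟨n, hn, -, hs⟩ := exists_iterate_toCfg a (j + 1)
  exact hs j hn

/-- The halting state is absorbing, so it persists until the machine time `n ≥ j` that represents
the `j`-th stack configuration. -/
theorem stackStep_iterate_of_state {a : List Prog × (ℕ → ℕ)} {j : ℕ}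
    (h : ((Cfg.step progInstr)^[j] (toCfg a)).state = ([], 0)) : (stackStep^[j] a).1 = [] := by
  obtain ⟨n, hn, he, -⟩ := exists_iterate_toCfg a j
  have absorb : ∀ m (b : Cfg (List Prog × Fin 3) (Option ℕ)), b.state = ([], 0) →
      ((Cfg.step progInstr)^[m] b).state = ([], 0) := by
    intro m
    induction m with
    | zero => exact fun b hb => hb
    | succ m ih =>
      intro b hb
      rw [iterate_succ_apply]
      apply ih
      rw [Cfg.step]
      split_ifs <;> simp [hb, progInstr]
  have := absorb (n - j) _ h
  rw [← iterate_add_apply, Nat.sub_add_cancel hn, he] at this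
  simpa [toCfg] using this

/-- The states of the marker machine executing `P`. -/
def progStates (P : Prog) : Set (List Prog × Fin 3) :=
  (subStacks P [] ∪ {[]}) ×ˢ Set.univ

theorem finite_progStates (P : Prog) : (progStates P).Finite :=
  ((finite_subStacks P []).union (Set.finite_singleton _)).prod Set.finite_univ

theorem next_mem_progStates {P : Prog} {q : List Prog × Fin 3} (hq : q ∈ progStates P) :
    (progInstr q).nextGe ∈ progStates P ∧ (progInstr q).nextLt ∈ progStates P := by
  have hnil : ([] : List Prog) ∈ subStacks P [] ∪ {[]} := .inr rfl
  have hstep : ∀ L ∈ subStacks P [] ∪ {[]}, ∀ σ, (stackStep (L, σ)).1 ∈ subStacks P [] ∪ {[]} := by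
    rintro L (h | h) σ
    · exact stackStep_mem_subStacks σ h
    · obtain rfl : L = [] := h
      exact hnil
  obtain ⟨L, i⟩ := q
  replace hq : L ∈ subStacks P [] ∪ {[]} := hq.1
  -- A loop branches on whether its register vanishes; the constant register contents `0` and `1`
  -- exhibit both branches.
  have h0 := hstep L hq 0
  have h1 := hstep L hq 1
  suffices (progInstr (L, i)).nextGe.1 ∈ subStacks P [] ∪ {[]} ∧
      (progInstr (L, i)).nextLt.1 ∈ subStacks P [] ∪ {[]} from
    ⟨⟨this.1, trivial⟩, ⟨this.2, trivial⟩⟩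
  obtain _ | ⟨_ | a | ⟨P, Q⟩ | ⟨a, P⟩, K⟩ := L <;> fin_cases i <;>
    simp_all [progInstr, stackStep, afterPush]

theorem state_iterate_mem {P : Prog} {a : Cfg (List Prog × Fin 3) (Option ℕ)}
    (h : a.state ∈ progStates P) (j : ℕ) :
    ((Cfg.step progInstr)^[j] a).state ∈ progStates P := by
  induction j with
  | zero => exact h
  | succ j ih =>
    rw [iterate_succ_apply', Cfg.step]
    split_ifs
    · exact (next_mem_progStates ih).1
    · exact (next_mem_progStates ih).2

/-! ### Truncation and rounding near powers of ten -/

theorem expo_eq {x : ℚ} {a : ℤ} (h₁ : (10 : ℚ) ^ a ≤ x) (h₂ : x < 10 ^ (a + 1)) :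
    expo x = a + 1 := by
  have hx : 0 < x := lt_of_lt_of_le (by positivity) h₁
  have h₃ : a ≤ Int.log 10 x := (Int.zpow_le_iff_le_log (by norm_num) hx).1 (by exact_mod_cast h₁)
  have h₄ : Int.log 10 x < a + 1 :=
    (Int.lt_zpow_iff_log_lt (by norm_num) hx).1 (by exact_mod_cast h₂)
  rw [expo, abs_of_pos hx]
  omega

theorem trunc_eq {p : ℕ} {x : ℚ} {a m : ℤ} (h₁ : (10 : ℚ) ^ a ≤ x) (h₂ : x < 10 ^ (a + 1))
    (h₃ : m * (10 : ℚ) ^ (a - p) ≤ x) (h₄ : x < (m + 1) * (10 : ℚ) ^ (a - p)) :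
    trunc (p + 1) x = m * 10 ^ (a - p) := by
  have hx : 0 < x := lt_of_lt_of_le (by positivity) h₁
  have hp : (0 : ℚ) < 10 ^ (a - p) := by positivity
  have e : ((p + 1 : ℕ) : ℤ) - (a + 1) = -(a - p) := by push_cast; ring
  have e' : (a + 1) - ((p + 1 : ℕ) : ℤ) = a - p := by push_cast; ring
  have hf : ⌊x * 10 ^ (-(a - (p : ℤ)))⌋ = m := by
    rw [Int.floor_eq_iff, zpow_neg, ← div_eq_mul_inv, le_div_iff₀ hp, div_lt_iff₀ hp]
    exact ⟨h₃, h₄⟩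
  rw [trunc, expo_eq h₁ h₂, abs_of_pos hx, sign_pos hx, e, e', hf]
  simp

theorem ten_zpow_add (a : ℤ) (p : ℕ) : (10 : ℚ) ^ a = 10 ^ p * 10 ^ (a - p) := by
  rw [← zpow_natCast, ← zpow_add₀ (by norm_num)]
  congr 1
  ring

/-- Absorption of numbers that are smaller by `p + 1` orders of magnitude. -/
theorem trunc_add_small {p : ℕ} {a : ℤ} {z : ℚ} (h₀ : 0 ≤ z) (h₁ : z < 10 ^ (a - p)) :
    trunc (p + 1) (10 ^ a + z) = 10 ^ a := by
  have hp : (1 : ℚ) ≤ 10 ^ p := one_le_pow₀ (by norm_num)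
  have hq : (0 : ℚ) < 10 ^ (a - (p : ℤ)) := by positivity
  have e := ten_zpow_add a p
  have e₁ : (10 : ℚ) ^ (a + 1) = 10 * 10 ^ a := by rw [zpow_add₀ (by norm_num)]; ring
  have := trunc_eq (p := p) (x := 10 ^ a + z) (a := a) (m := 10 ^ p) (by linarith)
    (by rw [e₁]; nlinarith) (by push_cast; linarith) (by push_cast; linarith)
  rw [this, e]
  push_cast
  rfl

theorem trunc_two_mul {p : ℕ} (a : ℤ) : trunc (p + 1) (2 * 10 ^ a) = 2 * 10 ^ a := by
  have hq : (0 : ℚ) < 10 ^ (a - (p : ℤ)) := by positivity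
  have ha : (0 : ℚ) < 10 ^ a := by positivity
  have e := ten_zpow_add a p
  have e₁ : (10 : ℚ) ^ (a + 1) = 10 * 10 ^ a := by rw [zpow_add₀ (by norm_num)]; ring
  have := trunc_eq (p := p) (x := 2 * 10 ^ a) (a := a) (m := 2 * 10 ^ p) (by linarith)
    (by rw [e₁]; linarith) (by push_cast; linarith) (by push_cast; linarith)
  rw [this, e]
  push_cast
  ring

theorem isFloat_mul_zpow {p : ℕ} (hp : 1 ≤ p) {m : ℤ} (hm : 1 ≤ m) (hm' : m < 10) (a : ℤ) :
    IsFloat p (m * 10 ^ a) := by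
  obtain ⟨p, rfl⟩ : ∃ k, p = k + 1 := ⟨p - 1, by omega⟩
  have h : ((m * 10 ^ p : ℤ) : ℚ) / 10 ^ (p + 1) = m / 10 := by
    push_cast
    field_simp
    ring
  have h₁ : (1 : ℚ) ≤ m := by exact_mod_cast hm
  have h₂ : (m : ℚ) < 10 := by exact_mod_cast hm'
  refine ⟨m * 10 ^ p, a + 1, ?_, .inr ?_⟩
  · rw [h, zpow_add₀ (by norm_num)]
    ring
  · rw [h, abs_of_pos (by positivity)]
    constructor <;> linarith

namespace IsRounding

variable {p : ℕ} {r : ℚ → ℚ}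

theorem map_zero (hr : IsRounding p r) : r 0 = 0 := by
  simpa using hr.sign_preserving 0

theorem eq_self (hr : IsRounding p r) {x : ℚ} (hx : IsFloat p x) (ht : trunc (p + 1) x = x) :
    r x = x := by
  have := hr.closest x x hx
  rw [ht, sub_self, abs_zero, abs_nonpos_iff, sub_eq_zero] at this
  exact this

theorem map_zpow (hr : IsRounding p r) (hp : 1 ≤ p) (a : ℤ) : r (10 ^ a) = 10 ^ a :=
  hr.eq_self (by simpa using isFloat_mul_zpow hp (m := 1) (by norm_num) (by norm_num) a)
    (by simpa using trunc_add_small (p := p) (a := a) (z := 0) le_rfl (by positivity))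

theorem map_two_mul_zpow (hr : IsRounding p r) (hp : 1 ≤ p) (a : ℤ) :
    r (2 * 10 ^ a) = 2 * 10 ^ a :=
  hr.eq_self (by simpa using isFloat_mul_zpow hp (m := 2) (by norm_num) (by norm_num) a)
    (trunc_two_mul a)

theorem map_add_small (hr : IsRounding p r) (hp : 1 ≤ p) {a b : ℤ} (h : b < a - p) :
    r (10 ^ a + 10 ^ b) = 10 ^ a := by
  rw [← hr.map_zpow hp a]
  apply hr.finite_digits
  have h₁ := trunc_add_small (p := p) (a := a) (z := 10 ^ b) (by positivity)
    (zpow_lt_zpow_right₀ (by norm_num) h)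
  have h₂ := trunc_add_small (p := p) (a := a) (z := 0) le_rfl (by positivity)
  rw [add_zero] at h₂
  rw [hr.map_zpow hp, h₁, h₂]

/-- Truncation leaves `10 ^ b - w`, with `w` one unit of the last kept digit. As `10 ^ b` is a
candidate at distance `w`, the result lies in `[10 ^ b - 2 * w, 10 ^ b]`. A positive float with
exponent at most `b` is at most `10 ^ b - 10 * w`, and one with larger exponent is at least `10 ^
b`, so only `10 ^ b` remains. No tie arises. -/
theorem map_sub_small (hr : IsRounding p r) (hp : 1 ≤ p) {a b : ℤ} (h : a < b - p) :
    r (10 ^ b - 10 ^ a) = 10 ^ b := by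
  set w : ℚ := 10 ^ (b - 1 - p) with hw
  have hw0 : 0 < w := by positivity
  have hp1 : (10 : ℚ) ≤ 10 ^ p := by simpa using pow_le_pow_right₀ (by norm_num : (1 : ℚ) ≤ 10) hp
  have haw : (10 : ℚ) ^ a ≤ w := zpow_le_zpow_right₀ (by norm_num) (by omega)
  have ha0 : (0 : ℚ) < 10 ^ a := by positivity
  have e₁ : (10 : ℚ) ^ (b - 1) = 10 ^ p * w := ten_zpow_add _ _
  have e₂ : (10 : ℚ) ^ b = 10 * 10 ^ (b - 1) := by
    rw [← zpow_one_add₀ (by norm_num)]; congr 1; ring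
  have ht : trunc (p + 1) (10 ^ b - 10 ^ a) = 10 ^ b - w := by
    rw [trunc_eq (a := b - 1) (m := 10 ^ (p + 1) - 1)]
    · push_cast
      rw [← hw, e₂, e₁]
      ring
    · rw [e₂, e₁]
      nlinarith
    · rw [sub_add_cancel]
      linarith
    · push_cast
      rw [← hw, e₂, e₁, pow_succ]
      linarith
    · push_cast
      rw [← hw, e₂, e₁, pow_succ]
      linarith
  have hc := hr.closest (10 ^ b - 10 ^ a) (10 ^ b)
    (by simpa using isFloat_mul_zpow hp (m := 1) (by norm_num) (by norm_num) b)
  rw [ht, sub_sub_cancel, abs_of_pos hw0, abs_le] at hc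
  obtain ⟨k, α, hk, hk'⟩ := hr.isFloat (10 ^ b - 10 ^ a)
  set y := r (10 ^ b - 10 ^ a)
  have hα : (0 : ℚ) < 10 ^ α := by positivity
  have hpp : (0 : ℚ) < 10 ^ p := by positivity
  have hy : 0 < y := by
    rw [e₂, e₁] at hc
    nlinarith
  have hk0 : (0 : ℚ) < k / 10 ^ p := by
    rw [hk] at hy
    exact pos_of_mul_pos_left hy hα.le
  have hkne : k ≠ 0 := by
    rintro rfl
    simp at hk0
  obtain ⟨h₁, h₂⟩ := hk'.resolve_left hkne
  rw [abs_of_pos hk0] at h₁ h₂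
  rcases le_or_gt α b with hab | hab
  · exfalso
    have hk2 : (k : ℚ) ≤ 10 ^ p - 1 := by
      rw [div_lt_one hpp] at h₂
      have : k < 10 ^ p := by exact_mod_cast h₂
      have : k ≤ 10 ^ p - 1 := by omega
      exact_mod_cast this
    have h₃ : (10 : ℚ) ^ α ≤ 10 ^ b := zpow_le_zpow_right₀ (by norm_num) hab
    have h₄ : y ≤ (10 ^ p - 1) / 10 ^ p * 10 ^ b := by
      have h₅ : (k : ℚ) / 10 ^ p ≤ (10 ^ p - 1) / 10 ^ p := by gcongr
      rw [hk]
      exact mul_le_mul h₅ h₃ hα.le (hk0.le.trans h₅)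
    have e₄ : ((10 : ℚ) ^ p - 1) / 10 ^ p * 10 ^ b = 10 ^ b - 10 * w := by
      rw [e₂, e₁]
      field_simp
    linarith [hc.1]
  · have h₃ : (10 : ℚ) ^ (b + 1) ≤ 10 ^ α := zpow_le_zpow_right₀ (by norm_num) (by omega)
    have h₄ : (10 : ℚ) ^ (b + 1) = 10 * 10 ^ b := by rw [zpow_add₀ (by norm_num)]; ring
    have h₅ : (10 : ℚ) ^ b ≤ y := by
      rw [hk]
      nlinarith
    linarith [hc.2]

end IsRounding

/-! ### Comparison by rounding and the linear simulation -/

/-- The base in which positions are represented. -/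
def base (p : ℕ) : ℚ := 10 ^ (p + 1)

theorem base_pos (p : ℕ) : 0 < base p := by unfold base; positivity

theorem base_zpow (p : ℕ) (a : ℤ) : base p ^ a = 10 ^ ((p + 1 : ℕ) * a) := by
  rw [base, ← zpow_natCast, ← zpow_mul]

theorem IsRounding.map_base_zpow {p : ℕ} {r : ℚ → ℚ} (hr : IsRounding p r) (hp : 1 ≤ p) (a : ℤ) :
    r (base p ^ a) = base p ^ a := by
  rw [base_zpow, hr.map_zpow hp]

/-- Rounded addition and subtraction compare powers of the base. -/
theorem IsRounding.map_sub_base_zpow {p : ℕ} {r : ℚ → ℚ} (hr : IsRounding p r) (hp : 1 ≤ p)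
    (a b : ℤ) :
    r (r (base p ^ a + base p ^ b) - base p ^ a) = if a ≤ b then base p ^ b else 0 := by
  simp only [base_zpow]
  -- Distinct powers of the base are at least `p + 1` decimal orders apart, just beyond the gap `p`
  -- that both absorption lemmas require.
  have key : ∀ {a b : ℤ}, a < b → ((p + 1 : ℕ) : ℤ) * a < (p + 1 : ℕ) * b - p := by
    intro a b h
    push_cast
    nlinarith
  rcases lt_trichotomy a b with h | rfl | h
  · rw [add_comm, hr.map_add_small hp (key h), hr.map_sub_small hp (key h), if_pos h.le]
  · rw [← two_mul, hr.map_two_mul_zpow hp, if_pos le_rfl, two_mul, add_sub_cancel_right,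
      hr.map_zpow hp]
  · rw [hr.map_add_small hp (key h), sub_self, hr.map_zero, if_neg (not_le.2 h)]

/-- One step of the rounded system given by an arbitrary map `F`. -/
def roundStep (r : ℚ → ℚ) {ι : Type} (F : (ι → ℚ) → ι → ℚ) (v : ι → ℚ) : ι → ℚ :=
  fun i => r (F v i)

/-- Transport from a convenient index type to `Fin d`. The hypothesis `hx` absorbs the rounding of
the initial vector. -/
theorem orbit_toMatrix (r : ℚ → ℚ) {ι : Type} {d : ℕ} (e : ι ≃ Fin d)
    (F : (ι → ℚ) →ₗ[ℚ] ι → ℚ) (x : ι → ℚ) (hx : ∀ i, r (x i) = x i) (t : ℕ) :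
    orbit r (LinearMap.toMatrix'
      (LinearMap.funLeft ℚ ℚ e.symm ∘ₗ F ∘ₗ LinearMap.funLeft ℚ ℚ e)) (x ∘ e.symm) t =
      (roundStep r F)^[t] x ∘ e.symm := by
  induction t with
  | zero =>
    ext i
    simp [orbit, hx]
  | succ t ih =>
    ext i
    rw [orbit, ih, iterate_succ_apply']
    have : (LinearMap.funLeft ℚ ℚ e) ((roundStep r F)^[t] x ∘ e.symm) = (roundStep r F)^[t] x := by
      ext j
      simp [LinearMap.funLeft_apply]
    simp [LinearMap.toMatrix'_mulVec, this, LinearMap.funLeft_apply, roundStep]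

section Simulation

variable {Q V : Type} [DecidableEq Q]

/-- The linear map simulating the marker machine `I` with states in `S`. The coordinates
`(q, i)` are, for `i = 0, …, 6`: the marker of `q`, its previous value, the head if the state is
`q`, its previous two values, the sum of the marker and the head, and the comparison of the
previous values of the head and the marker. -/
def simMap [DecidableEq V] (B : ℚ) (I : Q → Instr Q V) (S : Finset Q) :
    (S × Fin 7 → ℚ) →ₗ[ℚ] (S × Fin 7 → ℚ) :=
  IsLinearMap.mk' (fun v i => match i with
    | (q, 0) => v (q, 0) + ∑ q' : S, if (I q').mark = (I q).mark then
        (B ^ (I q').push - 1) * v (q', 6) else 0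
    | (q, 1) => v (q, 0)
    | (q, 2) => ∑ q' : S, ((if (I q').nextGe = q then B ^ (I q').shiftGe * v (q', 6) else 0) +
        if (I q').nextLt = q then B ^ (I q').shiftLt * (v (q', 4) - v (q', 6)) else 0)
    | (q, 3) => v (q, 2)
    | (q, 4) => v (q, 3)
    | (q, 5) => v (q, 0) + v (q, 2)
    | (q, 6) => v (q, 5) - v (q, 1)) <| by
  constructor
  · intro v w
    ext ⟨q, i⟩
    fin_cases i
    · simp only [Pi.add_apply]
      rw [add_add_add_comm, ← Finset.sum_add_distrib]
      congr 1
      refine Finset.sum_congr rfl fun q' _ => ?_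
      split_ifs <;> ring
    · rfl
    · simp only [Pi.add_apply]
      rw [← Finset.sum_add_distrib]
      refine Finset.sum_congr rfl fun q' _ => ?_
      split_ifs <;> ring
    · rfl
    · rfl
    · simp only [Pi.add_apply]
      ring
    · simp only [Pi.add_apply]
      ring
  · intro c v
    ext ⟨q, i⟩
    fin_cases i
    · simp only [Pi.smul_apply, smul_eq_mul]
      rw [mul_add, Finset.mul_sum]
      congr 1
      refine Finset.sum_congr rfl fun q' _ => ?_
      split_ifs <;> ring
    · rfl
    · simp only [Pi.smul_apply, smul_eq_mul]
      rw [Finset.mul_sum]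
      refine Finset.sum_congr rfl fun q' _ => ?_
      split_ifs <;> ring
    · rfl
    · rfl
    · simp only [Pi.smul_apply, smul_eq_mul]
      ring
    · simp only [Pi.smul_apply, smul_eq_mul]
      ring

/-- The vector representing the configuration `a`, where the markers previously were at `c`. -/
def simVec (B : ℚ) (I : Q → Instr Q V) (S : Finset Q) (a : Cfg Q V) (c : V → ℤ) :
    S × Fin 7 → ℚ
  | (q, 0) => B ^ a.pos (I q).mark
  | (q, 1) => B ^ c (I q).mark
  | (q, 2) => if (q : Q) = a.state then B ^ a.head else 0
  | (q, 5) => B ^ c (I q).mark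
  | _ => 0

/-- The first vector between the representations of `a` and its successor. -/
def simVec₁ (B : ℚ) (r : ℚ → ℚ) (I : Q → Instr Q V) (S : Finset Q) (a : Cfg Q V) :
    S × Fin 7 → ℚ
  | (q, 0) => B ^ a.pos (I q).mark
  | (q, 1) => B ^ a.pos (I q).mark
  | (q, 3) => if (q : Q) = a.state then B ^ a.head else 0
  | (q, 5) => r (B ^ a.pos (I q).mark + if (q : Q) = a.state then B ^ a.head else 0)
  | _ => 0

/-- The second vector between the representations of `a` and its successor. -/
def simVec₂ (B : ℚ) (I : Q → Instr Q V) (S : Finset Q) (a : Cfg Q V) : S × Fin 7 → ℚ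
  | (q, 0) => B ^ a.pos (I q).mark
  | (q, 1) => B ^ a.pos (I q).mark
  | (q, 4) => if (q : Q) = a.state then B ^ a.head else 0
  | (q, 5) => B ^ a.pos (I q).mark
  | (q, 6) => if (q : Q) = a.state then
      (if a.pos (I a.state).mark ≤ a.head then B ^ a.head else 0) else 0
  | _ => 0

variable {p : ℕ} {r : ℚ → ℚ} (I : Q → Instr Q V) (S : Finset Q)

theorem round_simVec (hr : IsRounding p r) (hp : 1 ≤ p) (a : Cfg Q V) (c : V → ℤ) (i : S × Fin 7) :
    r (simVec (base p) I S a c i) = simVec (base p) I S a c i := by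
  have h := hr.map_base_zpow hp
  have h0 := hr.map_zero
  obtain ⟨q, i⟩ := i
  fin_cases i <;> simp [simVec, h, h0]
  split_ifs <;> simp [h, h0]

variable [DecidableEq V]

theorem roundStep_simVec (hr : IsRounding p r) (hp : 1 ≤ p) (a : Cfg Q V) (c : V → ℤ) :
    roundStep r (simMap (base p) I S) (simVec (base p) I S a c) = simVec₁ (base p) r I S a := by
  have h := hr.map_base_zpow hp
  have h0 := hr.map_zero
  ext ⟨q, i⟩
  fin_cases i <;> simp [roundStep, simMap, simVec, simVec₁, h, h0]
  split_ifs <;> simp [h, h0]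

/-- The comparison happens here, in coordinate `6`. For states other than the current one the head
contributes zero and the difference cancels, so only the current instruction is triggered. -/
theorem roundStep_simVec₁ (hr : IsRounding p r) (hp : 1 ≤ p) (a : Cfg Q V) :
    roundStep r (simMap (base p) I S) (simVec₁ (base p) r I S a) = simVec₂ (base p) I S a := by
  have h := hr.map_base_zpow hp
  have h0 := hr.map_zero
  have hg := hr.map_sub_base_zpow hp
  ext ⟨q, i⟩
  fin_cases i <;> simp [roundStep, simMap, simVec₁, simVec₂, h, h0]
  · split_ifs <;> simp [h, h0]
  · by_cases hq : (q : Q) = a.state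
    · simp only [hq, if_true, hg]
    · simp [hq, h, h0]

/-- Adding `(B ^ push - 1) * B ^ head` multiplies a marker by `B ^ push` only when head and marker
coincide. If the push is nonzero, `Safe` together with a successful comparison forces this. -/
theorem roundStep_simVec₂ (hr : IsRounding p r) (hp : 1 ≤ p) (a : Cfg Q V) (ha : a.state ∈ S)
    (hs : a.Safe I) :
    roundStep r (simMap (base p) I S) (simVec₂ (base p) I S a) =
      simVec (base p) I S (a.step I) a.pos := by
  have h := hr.map_base_zpow hp
  have h0 := hr.map_zero
  have hB := (base_pos p).ne'
  have hne : ∀ q : S, q ≠ ⟨a.state, ha⟩ → (q : Q) ≠ a.state := fun q hq hq' => hq (Subtype.ext hq')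
  ext ⟨q, i⟩
  match i with
  | 0 =>
    simp only [roundStep, simMap, IsLinearMap.mk'_apply, simVec₂, simVec]
    rw [Finset.sum_eq_single (⟨a.state, ha⟩ : S) (fun q' _ hq' => by simp [hne q' hq'])
      (by simp)]
    unfold Cfg.step
    by_cases hm : (I a.state).mark = (I q).mark
    · simp only [if_true, hm]
      simp only [Cfg.Safe, hm] at hs
      by_cases hle : a.pos (I q).mark ≤ a.head
      · simp only [hle, if_true, update_self]
        rw [← h (_ + _)]
        congr 1
        rcases hs with hs | hs
        · simp [hs]
        · rw [le_antisymm hle hs, zpow_add₀ hB]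
          ring
      · simp [hle, h]
    · simp only [hm, if_false, add_zero, h]
      split_ifs
      · simp only
        rw [update_of_ne (Ne.symm hm)]
      · rfl
  | 2 =>
    simp only [roundStep, simMap, IsLinearMap.mk'_apply, simVec₂, simVec]
    rw [Finset.sum_eq_single (⟨a.state, ha⟩ : S) (fun q' _ hq' => by simp [hne q' hq'])
      (by simp)]
    unfold Cfg.step
    simp only [if_true]
    by_cases hle : a.pos (I a.state).mark ≤ a.head
    · simp only [hle, if_true, sub_self, mul_zero, ite_self, add_zero, eq_comm (a := (q : Q))]
      split_ifs
      · rw [← zpow_add₀ hB, h, add_comm]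
      · exact h0
    · simp only [hle, if_false, sub_zero, mul_zero, ite_self, zero_add, eq_comm (a := (q : Q))]
      split_ifs
      · rw [← zpow_add₀ hB, h, add_comm]
      · exact h0
  | 1 | 3 | 4 | 5 | 6 => simp [roundStep, simMap, simVec, simVec₂, h, h0]

/-- The vector also records the previous marker positions. The first part forgets them; the second
identifies them, as needed to hit a prescribed target. -/
theorem iterate_roundStep_simVec (hr : IsRounding p r) (hp : 1 ≤ p) (a : Cfg Q V) (c : V → ℤ)
    (ha : ∀ j, ((Cfg.step I)^[j] a).state ∈ S) (hs : ∀ j, ((Cfg.step I)^[j] a).Safe I) (j : ℕ) :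
    (∃ c', (roundStep r (simMap (base p) I S))^[3 * j] (simVec (base p) I S a c) =
      simVec (base p) I S ((Cfg.step I)^[j] a) c') ∧
    (roundStep r (simMap (base p) I S))^[3 * j + 3] (simVec (base p) I S a c) =
      simVec (base p) I S ((Cfg.step I)^[j + 1] a) ((Cfg.step I)^[j] a).pos := by
  have key : ∀ j c', (roundStep r (simMap (base p) I S))^[3]
      (simVec (base p) I S ((Cfg.step I)^[j] a) c') =
      simVec (base p) I S ((Cfg.step I)^[j + 1] a) ((Cfg.step I)^[j] a).pos := by
    intro j c'
    rw [iterate_succ_apply', iterate_succ_apply', iterate_one, roundStep_simVec I S hr hp,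
      roundStep_simVec₁ I S hr hp, roundStep_simVec₂ I S hr hp _ (ha j) (hs j),
      iterate_succ_apply']
  induction j with
  | zero => exact ⟨⟨c, rfl⟩, by simpa using key 0 c⟩
  | succ j ih =>
    have h := ih.2
    refine ⟨⟨_, h⟩, ?_⟩
    rw [add_comm, iterate_add_apply, mul_add, mul_one, h, key]

/-- If the rounded system reaches a representation of `b`, then the machine reaches its state. -/
theorem exists_state_of_roundStep (hr : IsRounding p r) (hp : 1 ≤ p) {a b : Cfg Q V} {c c' : V → ℤ}
    (ha : ∀ j, ((Cfg.step I)^[j] a).state ∈ S) (hs : ∀ j, ((Cfg.step I)^[j] a).Safe I)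
    (hb : b.state ∈ S) {t : ℕ}
    (h : (roundStep r (simMap (base p) I S))^[t] (simVec (base p) I S a c) =
      simVec (base p) I S b c') : ∃ j, ((Cfg.step I)^[j] a).state = b.state := by
  obtain ⟨⟨c'', hc⟩, -⟩ := iterate_roundStep_simVec I S hr hp a c ha hs (t / 3)
  have hB : base p ^ b.head ≠ 0 := zpow_ne_zero _ (base_pos p).ne'
  have hmod : t = t % 3 + 3 * (t / 3) := by omega
  rw [hmod, iterate_add_apply, hc] at h
  -- This coordinate is nonzero in the target but zero in both intermediate vectors, and at the
  -- start of a round it is nonzero only if the current state is `b.state`.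
  have h2 := congrFun h (⟨b.state, hb⟩, 2)
  have hcases : t % 3 = 0 ∨ t % 3 = 1 ∨ t % 3 = 2 := by omega
  rcases hcases with ht | ht | ht <;> rw [ht] at h2
  · refine ⟨t / 3, ?_⟩
    by_contra hne
    simp [simVec, Ne.symm hne, hB.symm] at h2
  · rw [iterate_one, roundStep_simVec I S hr hp] at h2
    simp [simVec, simVec₁, hB.symm] at h2
  · rw [iterate_succ_apply', iterate_one, roundStep_simVec I S hr hp,
      roundStep_simVec₁ I S hr hp] at h2
    simp [simVec, simVec₂, hB.symm] at h2

end Simulation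

/-! ### Computability of the reduction and conclusion -/

theorem primrec_intCast : Primrec fun n : ℕ => (n : ℤ) := by
  rw [← Primrec.encode_iff]
  have : ∀ n : ℕ, Encodable.encode (n : ℤ) = 2 * n := fun n => by
    rfl
  simp only [this]
  exact Primrec.nat_mul.comp (.const 2) .id

theorem computable_pow (b : ℕ) : Computable fun n : ℕ => b ^ n := by
  have : Primrec fun n : ℕ => b ^ n := by
    refine (Primrec.nat_rec₁ 1 (f := fun _ k => k * b)
      (Primrec.nat_mul.comp Primrec.snd (.const b))).of_eq fun n => ?_
    induction n with
    | zero => rfl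
    | succ n ih => simp only [ih, pow_succ]
  exact this.to_comp

theorem computable_ratCode_base_zpow (p : ℕ) :
    Computable fun n : ℕ => ratCode (base p ^ (n : ℤ)) := by
  have : ∀ n : ℕ, ratCode (base p ^ (n : ℤ)) = ((((10 ^ (p + 1)) ^ n : ℕ) : ℤ), 1) := fun n => by
    have h : base p ^ (n : ℤ) = (((10 ^ (p + 1)) ^ n : ℕ) : ℚ) := by
      rw [zpow_natCast, base]
      push_cast
      rfl
    rw [h, ratCode, Rat.num_natCast, Rat.den_natCast]
  simp only [this]
  exact (primrec_intCast.to_comp.comp (computable_pow _)).pair (.const 1)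

theorem computable_ratCode_simVec {Q : Type} [DecidableEq Q] (p : ℕ) (I : Q → Instr Q (Option ℕ))
    (S : Finset Q) (q : Q) (s : ℤ) (i : S × Fin 7) :
    Computable fun n : ℕ => ratCode (simVec (base p) I S ⟨q, s, markerPos (update 0 0 n)⟩
      (markerPos (update 0 0 n)) i) := by
  have h : ∀ m : Option ℕ,
      Computable fun n : ℕ => ratCode (base p ^ markerPos (update 0 0 n) m) := by
    rintro (_ | _ | a)
    · exact Computable.const (ratCode (base p ^ (1 : ℤ)))
    · simpa [markerPos] using computable_ratCode_base_zpow p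
    · exact (Computable.const (ratCode (base p ^ (0 : ℤ)))).of_eq fun n => by simp [markerPos]
  obtain ⟨q', i⟩ := i
  match i with
  | 0 | 1 | 5 => exact h _
  | 2 => exact .const (ratCode (if (q' : Q) = q then base p ^ s else 0))
  | 3 | 4 | 6 => exact .const (ratCode 0)

/-- The linear dynamical system simulating the program `P`, with input `n`; the target is the
configuration in which `P` has terminated with all registers cleared. -/
noncomputable def progInstance (p : ℕ) (S : Finset (List Prog × Fin 3)) (P : Prog) (n : ℕ) :
    Instance :=
  open Classical in
  let e := Fintype.equivFin (S × Fin 7)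
  { d := Fintype.card (S × Fin 7)
    M := LinearMap.toMatrix' (LinearMap.funLeft ℚ ℚ e.symm ∘ₗ simMap (base p) progInstr S ∘ₗ
      LinearMap.funLeft ℚ ℚ e)
    x := simVec (base p) progInstr S (toCfg ([P], update 0 0 n)) (markerPos (update 0 0 n)) ∘ e.symm
    y := simVec (base p) progInstr S (toCfg ([], 0)) (markerPos 0) ∘ e.symm }

/-- Reaching the target already gives halting through the control state alone. The converse must hit
one exact vector, so `hP` requires every halting run to end with empty registers. -/
theorem reaches_progInstance_iff {p : ℕ} (hp : 1 ≤ p) {r : ℚ → ℚ} (hr : IsRounding p r)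
    {S : Finset (List Prog × Fin 3)} {P : Prog} (hS : ∀ q, q ∈ S ↔ q ∈ progStates P) {n : ℕ}
    (hP : ∀ τ, Prog.Big P (update 0 0 n) τ → τ = 0) :
    (progInstance p S P n).Reaches r ↔ ∃ τ, Prog.Big P (update 0 0 n) τ := by
  classical
  set a := toCfg ([P], update 0 0 n) with ha_def
  set b := toCfg ([], 0) with hb_def
  have ha : ∀ j, ((Cfg.step progInstr)^[j] a).state ∈ S := fun j =>
    (hS _).2 (state_iterate_mem ⟨.inl (self_mem_subStacks P []), trivial⟩ j)
  have hs : ∀ j, ((Cfg.step progInstr)^[j] a).Safe progInstr := fun j => safe_iterate_toCfg _ j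
  have hb : b.state ∈ S := (hS _).2 ⟨.inr rfl, trivial⟩
  have horbit := orbit_toMatrix r (Fintype.equivFin (S × Fin 7)) (simMap (base p) progInstr S) _
    (round_simVec progInstr S hr hp a (markerPos (update 0 0 n)))
  have hreach : (progInstance p S P n).Reaches r ↔
      ∃ t, (roundStep r (simMap (base p) progInstr S))^[t]
        (simVec (base p) progInstr S a (markerPos (update 0 0 n))) =
          simVec (base p) progInstr S b (markerPos 0) := by
    refine exists_congr fun t => ?_
    rw [← (Fintype.equivFin (S × Fin 7)).symm.surjective.injective_comp_right.eq_iff, ← horbit]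
    simp only [progInstance, ha_def, hb_def]
  rw [hreach]
  constructor
  · rintro ⟨t, ht⟩
    obtain ⟨j, hj⟩ := exists_state_of_roundStep progInstr S hr hp ha hs hb ht
    have hnil := stackStep_iterate_of_state hj
    exact ⟨_, exists_iterate_stackStep_iff.1 ⟨j, Prod.ext hnil rfl⟩⟩
  · rintro ⟨τ, hτ⟩
    obtain rfl := hP τ hτ
    obtain ⟨k, hk⟩ := exists_iterate_stackStep_iff.2 hτ
    obtain ⟨m, -, hm, -⟩ := exists_iterate_toCfg ([P], update 0 0 n) k
    rw [hk] at hm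
    have h := (iterate_roundStep_simVec progInstr S hr hp a (markerPos (update 0 0 n)) ha hs m).2
    -- Since the halting configuration is fixed, one further round makes the recorded previous
    -- markers equal to the current ones, as the target demands.
    have hfix : b.step progInstr = b := by
      simp [hb_def, Cfg.step, toCfg, progInstr]
    rw [iterate_succ_apply' (Cfg.step progInstr), show (Cfg.step progInstr)^[m] a = b from hm,
      hfix] at h
    exact ⟨3 * m + 3, h⟩

/-- Matrix and target do not depend on `n`, so they enter as constants; only the initial vector has
to be computed. -/
theorem computable_encode_progInstance (p : ℕ) (S : Finset (List Prog × Fin 3)) (P : Prog) :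
    Computable fun n => (progInstance p S P n).encode := by
  classical
  refine Computable.pair (.const (progInstance p S P 0).encode.1) (Computable.pair ?_
    (.const (progInstance p S P 0).encode.2.2))
  exact (Computable.list_ofFn fun i => computable_ratCode_simVec p progInstr S ([P], 0) 0
    ((Fintype.equivFin (S × Fin 7)).symm i)).of_eq fun n => rfl

theorem not_computablePred_reachability {p : ℕ} (hp : 1 ≤ p) {r : ℚ → ℚ} (hr : IsRounding p r) :
    ¬ ComputablePred (Reachability r) := by
  intro hcomp
  -- The function is universal: one program, hence one matrix, serves every code `c`, which enters
  -- as the input `Encodable.encode c`.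
  obtain ⟨P, hP⟩ := exists_prog_dom (f := fun n => (Denumerable.ofNat Nat.Partrec.Code n).eval 0)
    (Nat.Partrec.Code.eval_part.comp (Computable.ofNat _) (Computable.const 0))
  obtain ⟨S, hS⟩ : ∃ S : Finset (List Prog × Fin 3), ∀ q, q ∈ S ↔ q ∈ progStates P :=
    ⟨(finite_progStates P).toFinset, fun q => Set.Finite.mem_toFinset _⟩
  refine ComputablePred.halting_problem 0 (ComputablePred.computable_of_manyOneReducible
    ⟨fun c => (progInstance p S P (Encodable.encode c)).encode,
      (computable_encode_progInstance p S P).comp Computable.encode, fun c => ?_⟩ hcomp)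
  have hreach := reaches_progInstance_iff hp hr hS (n := Encodable.encode c)
    fun τ h => ((hP _ τ).1 h).2
  simp only [hP, Denumerable.ofNat_encode, exists_and_left, exists_eq,
    and_true] at hreach
  refine hreach.symm.trans ?_
  constructor
  · exact fun h => ⟨_, rfl, h⟩
  · rintro ⟨I, hI, h⟩
    rwa [Instance.encode_injective hI] at h

end FloatLDS

theorem theorem1 (p : ℕ) (hp : 1 ≤ p) (r : ℚ → ℚ) (hr : FloatLDS.IsRounding p r) :
    ¬ ComputablePred (FloatLDS.Reachability r) :=
  FloatLDS.not_computablePred_reachability hp hr
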